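/- **Logic.** Formulas are those of one-sorted second-order predicate logic with identity, with individual variables $x_i$ and predicate variables $A_i^n$ ($n\ge 1$, $i\in\mathbb N$) of arity $n$. A predicate structure $\Sigma=(J_n)_{n\ge 0}$ consists of a set of individuals $J_0=I$ and, for every $n\ge 1$, a non-empty set $J_n$ of $n$-ary predicates $\alpha:I^n\to\{true,false\}$. In $\Sigma$ the $n$-ary predicate quantifiers range over $J_n$ (Henkin interpretation), and $\Sigma\models H$ means that $H$ is true in $\Sigma$ under every assignment of individuals and of predicates in the $J_n$ to the variables. **The model.** Let $I=\{0,1\}\times\mathbb N$ and let $\mathfrak G$ be the group of all permutations $\pi$ of $I$ that map $\{0\}\times\mathbb N$ onto itself and $\{1\}\times\mathbb N$ onto itself. For $\pi\in\mathfrak G$ and an $n$-ary predicate $\alpha$ let $\alpha^\pi(\xi_1,\dots,\xi_n)=\alpha(\pi^{-1}(\xi_1),\dots,\pi^{-1}(\xi_n))$. The permutation model $2\Sigma_0=(J_n)_{n\ge 0}$ has $J_0=I$, and for $n\ge 1$ the set $J_n$ consists of all $n$-ary predicates $\alpha$ on $I$ that have a finite support, that is, for which there is a finite $P\subseteq I$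 such that $\alpha^\pi=\alpha$ for every $\pi\in\mathfrak G$ that fixes every element of $P$. **The principles.** Let $n,m\ge 1$. - $TR^n$ (trichotomy) is the sentence saying: for all $n$-ary predicates $A,B$ there is a $2n$-ary predicate that is the graph of an injective map of $\{\boldsymbol x\mid A\boldsymbol x\}$ into $\{\boldsymbol x\mid B\boldsymbol x\}$, or one that is the graph of an injective map of $\{\boldsymbol x\mid B\boldsymbol x\}$ into $\{\boldsymbol x\mid A\boldsymbol x\}$. - $LO^n$ (linear ordering) is the sentence saying: for every $n$-ary predicate $A$ there is a $2n$-ary predicate that is a linear ordering of $\{\boldsymbol x\mid A\boldsymbol x\}$. - $choice_h^{n,m}$ is the set of all formulas $$\forall\boldsymbol x\,\exists D\,H(\boldsymbol x,D)\ \to\ \exists S\,\forall\boldsymbol x\,\exists D\,\bigl(\forall\boldsymbol y\,(D\boldsymbol y\leftrightarrow S\boldsymbol x\boldsymbol y)\wedge H(\boldsymbol x,D)\bigr),$$ where $\boldsymbol x$ and $\boldsymbol y$ are tuples of $n$ and $m$ individual variables, all $n+m$ of them distinct, $D$ is an $m$-ary and $S$ an $(n+m)$-ary predicate variable, and $H$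 is any second-order formula in which $S$ does not occur free ($H$ may contain further free variables as parameters). **Proposition.** 1. $2\Sigma_0\models\neg TR^n$ for all $n\ge 1$. 2. $2\Sigma_0\models\neg LO^n$ for all $n\ge 1$. 3. $2\Sigma_0\models choice_h^{n,m}$ for all $n,m\ge 1$, that is, $2\Sigma_0\models H$ for every $H\in choice_h^{n,m}$. -/

import Mathlib

namespace HPL

/-! ### Syntax: one-sorted second-order predicate logic with identity -/

/-- Second-order formulas. Individual variables are `x_i` (`i : ℕ`), predicate variables of arity
`n ≥ 1` are `A_i^n` (`n : ℕ+`, `i : ℕ`). -/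
inductive Formula : Type
  /-- `x_i = x_j` -/
  | eq (i j : ℕ) : Formula
  /-- `A_i^n x_{v 0} … x_{v (n-1)}` -/
  | rel (n : ℕ+) (i : ℕ) (v : Fin n → ℕ) : Formula
  | not (φ : Formula) : Formula
  | and (φ ψ : Formula) : Formula
  | or (φ ψ : Formula) : Formula
  | imp (φ ψ : Formula) : Formula
  | iff (φ ψ : Formula) : Formula
  /-- `∀ x_i φ` -/
  | all (i : ℕ) (φ : Formula) : Formula
  /-- `∃ x_i φ` -/
  | ex (i : ℕ) (φ : Formula) : Formula
  /-- `∀ A_i^n φ` -/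
  | allPred (n : ℕ+) (i : ℕ) (φ : Formula) : Formula
  /-- `∃ A_i^n φ` -/
  | exPred (n : ℕ+) (i : ℕ) (φ : Formula) : Formula

/-- `FreePred n i φ`: the predicate variable `A_i^n` occurs free in `φ`. -/
def FreePred (n : ℕ+) (i : ℕ) : Formula → Prop
  | .eq _ _ => False
  | .rel k j _ => k = n ∧ j = i
  | .not φ => FreePred n i φ
  | .and φ ψ => FreePred n i φ ∨ FreePred n i ψ
  | .or φ ψ => FreePred n i φ ∨ FreePred n i ψ
  | .imp φ ψ => FreePred n i φ ∨ FreePred n i ψ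
  | .iff φ ψ => FreePred n i φ ∨ FreePred n i ψ
  | .all _ φ => FreePred n i φ
  | .ex _ φ => FreePred n i φ
  | .allPred k j φ => ¬ (k = n ∧ j = i) ∧ FreePred n i φ
  | .exPred k j φ => ¬ (k = n ∧ j = i) ∧ FreePred n i φ

/-! ### Semantics: predicate structures (Henkin interpretation) -/

/-- `n`-ary predicates on `I`. -/
abbrev Pred (n : ℕ+) (I : Type*) : Type _ := (Fin n → I) → Prop

/-- A predicate structure `(J_n)_{n ≥ 0}` with individual domain `J_0 = I` and, for each `n ≥ 1`, a
non-empty set `J_n` of `n`-ary predicates on `I`. -/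
structure PredStructure (I : Type*) where
  dom : (n : ℕ+) → Set (Pred n I)
  dom_nonempty : ∀ n, (dom n).Nonempty

/-- Values for all individual and all predicate variables. -/
structure Assignment (I : Type*) where
  ind : ℕ → I
  pred : (n : ℕ+) → ℕ → Pred n I

/-- Change the value of `x_i` to `ξ`. -/
def Assignment.setInd {I : Type*} (f : Assignment I) (i : ℕ) (ξ : I) : Assignment I :=
  { f with ind := Function.update f.ind i ξ }

/-- Change the value of `A_i^n` to `α`. -/
def Assignment.setPred {I : Type*} (f : Assignment I) (n : ℕ+) (i : ℕ) (α : Pred n I) :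
    Assignment I :=
  { f with pred := Function.update f.pred n (Function.update (f.pred n) i α) }

/-- `f` is an assignment in `S`: every predicate variable gets a value in the respective domain. -/
def Assignment.IsIn {I : Type*} (f : Assignment I) (S : PredStructure I) : Prop :=
  ∀ n i, f.pred n i ∈ S.dom n

/-- Truth of a formula in `S` under `f`; `n`-ary predicate quantifiers range over `S.dom n`. -/
def Sat {I : Type*} (S : PredStructure I) : Assignment I → Formula → Prop
  | f, .eq i j => f.ind i = f.ind j
  | f, .rel n i v => f.pred n i (fun k => f.ind (v k))
  | f, .not φ => ¬ Sat S f φ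
  | f, .and φ ψ => Sat S f φ ∧ Sat S f ψ
  | f, .or φ ψ => Sat S f φ ∨ Sat S f ψ
  | f, .imp φ ψ => Sat S f φ → Sat S f ψ
  | f, .iff φ ψ => (Sat S f φ ↔ Sat S f ψ)
  | f, .all i φ => ∀ ξ : I, Sat S (f.setInd i ξ) φ
  | f, .ex i φ => ∃ ξ : I, Sat S (f.setInd i ξ) φ
  | f, .allPred n i φ => ∀ α ∈ S.dom n, Sat S (f.setPred n i α) φ
  | f, .exPred n i φ => ∃ α ∈ S.dom n, Sat S (f.setPred n i α) φ

/-- `S ⊨ φ`: `φ` is true in `S` under every assignment in `S`. -/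
def Models {I : Type*} (S : PredStructure I) (φ : Formula) : Prop :=
  ∀ f : Assignment I, f.IsIn S → Sat S f φ

/-! ### Abbreviations for tuples of variables -/

/-- Concatenation of an `n`-tuple and an `m`-tuple. -/
def append {X : Type*} {n m : ℕ+} (x : Fin n → X) (y : Fin m → X) : Fin (n + m : ℕ+) → X :=
  fun i => Fin.append x y (i.cast (PNat.add_coe n m))

/-- `∀ x_{v 0} … ∀ x_{v (k-1)} φ` -/
def allTuple {k : ℕ} (v : Fin k → ℕ) (φ : Formula) : Formula :=
  (List.ofFn v).foldr Formula.all φ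

/-- `∃ x_{v 0} … ∃ x_{v (k-1)} φ` -/
def exTuple {k : ℕ} (v : Fin k → ℕ) (φ : Formula) : Formula :=
  (List.ofFn v).foldr Formula.ex φ

/-- Coordinatewise equality of tuples of variables (the last conjunct `x_0 = x_0` is trivial). -/
def eqTuple {k : ℕ} (v w : Fin k → ℕ) : Formula :=
  (List.ofFn fun i => Formula.eq (v i) (w i)).foldr Formula.and (Formula.eq 0 0)

/-- The `b`-th block of `n` individual variables, `(x_{b n}, …, x_{b n + n - 1})`. -/
def block (n : ℕ+) (b : ℕ) : Fin n → ℕ := fun i => b * n + i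

/-! ### The principles -/

/-- The `2n`-ary `A_h^{n+n}` is (the graph of) an injective map from `A_a^n` into `A_b^n`. -/
def injFormula (n : ℕ+) (h a b : ℕ) : Formula :=
  let x := block n 0
  let y := block n 1
  let z := block n 2
  let F := fun u v : Fin n → ℕ => Formula.rel (n + n) h (append u v)
  let A := fun u : Fin n → ℕ => Formula.rel n a u
  let B := fun u : Fin n → ℕ => Formula.rel n b u
  .and (allTuple x (allTuple y (.imp (F x y) (.and (A x) (B y)))))
    (.and (allTuple x (.imp (A x) (exTuple y (F x y))))
      (.and (allTuple x (allTuple y (allTuple z (.imp (.and (F x y) (F x z)) (eqTuple y z)))))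
        (allTuple x (allTuple y (allTuple z (.imp (.and (F x z) (F y z)) (eqTuple x y)))))))

/-- Trichotomy law `TR^n`: of any two `n`-ary predicates `A`, `B`, one can be mapped injectively
into the other one. -/
def TR (n : ℕ+) : Formula :=
  .allPred n 0 (.allPred n 1
    (.or (.exPred (n + n) 0 (injFormula n 0 0 1)) (.exPred (n + n) 0 (injFormula n 0 1 0))))

/-- The `2n`-ary `A_t^{n+n}` is a (reflexive) linear ordering on `A_a^n`. -/
def linFormula (n : ℕ+) (t a : ℕ) : Formula :=
  let x := block n 0
  let y := block n 1
  let z := block n 2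
  let T := fun u v : Fin n → ℕ => Formula.rel (n + n) t (append u v)
  let A := fun u : Fin n → ℕ => Formula.rel n a u
  .and (allTuple x (allTuple y (.imp (T x y) (.and (A x) (A y)))))
    (.and (allTuple x (.imp (A x) (T x x)))
      (.and (allTuple x (allTuple y (.imp (.and (T x y) (T y x)) (eqTuple x y))))
        (.and (allTuple x (allTuple y (allTuple z (.imp (.and (T x y) (T y z)) (T x z)))))
          (allTuple x (allTuple y (.imp (.and (A x) (A y)) (.or (T x y) (T y x))))))))

/-- Linear ordering principle `LO^n`: every `n`-ary predicate has a linear ordering. -/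
def LO (n : ℕ+) : Formula :=
  .allPred n 0 (.exPred (n + n) 0 (linFormula n 0 0))

/-- `∀x ∃D H(x,D) → ∃S ∀x ∃D (∀y (D y ↔ S x y) ∧ H(x,D))` where `D` is `A_d^m` and `S` is
`A_s^{n+m}`. -/
def choiceFormula (n m : ℕ+) (x : Fin n → ℕ) (y : Fin m → ℕ) (d s : ℕ) (H : Formula) : Formula :=
  .imp (allTuple x (.exPred m d H))
    (.exPred (n + m) s (allTuple x (.exPred m d
      (.and (allTuple y (.iff (.rel m d y) (.rel (n + m) s (append x y)))) H))))

/-- The choice principle `choice_h^{n,m}`: all formulas of the form above, where `x`, `y` are tuples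
of pairwise distinct variables, `H` is any formula in which the `(n+m)`-ary variable `S` does not
occur free (`H` may have free variables other than `x`, `D`, which are parameters). -/
def choiceH (n m : ℕ+) : Set Formula :=
  {φ | ∃ (x : Fin n → ℕ) (y : Fin m → ℕ) (d s : ℕ) (H : Formula),
    Function.Injective (append x y) ∧ ¬ FreePred (n + m) s H ∧ φ = choiceFormula n m x y d s H}

/-! ### Permutation models -/

/-- `α^π (ξ) = α (π⁻¹ ξ)` -/
def Pred.act {n : ℕ+} {I : Type*} (α : Pred n I) (π : Equiv.Perm I) : Pred n I :=
  fun ξ => α (fun i => π⁻¹ (ξ i))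

/-- `sym_G(α)` -/
def symSet {I : Type*} (G : Subgroup (Equiv.Perm I)) {n : ℕ+} (α : Pred n I) :
    Set (Equiv.Perm I) :=
  {π | π ∈ G ∧ Pred.act α π = α}

/-- `G(P) = fix_G(P)`, the pointwise stabilizer of `P`. -/
def fixSet {I : Type*} (G : Subgroup (Equiv.Perm I)) (P : Set I) : Set (Equiv.Perm I) :=
  {π | π ∈ G ∧ ∀ ξ ∈ P, π ξ = ξ}

/-- (Simple) normal ideals on `I` with respect to `G`. -/
structure NormalIdeal {I : Type*} (G : Subgroup (Equiv.Perm I)) where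
  sets : Set (Set I)
  empty_mem : ∅ ∈ sets
  subset_mem : ∀ P₁ ∈ sets, ∀ P₂ ⊆ P₁, P₂ ∈ sets
  union_mem : ∀ P₁ ∈ sets, ∀ P₂ ∈ sets, P₁ ∪ P₂ ∈ sets
  image_mem : ∀ P ∈ sets, ∀ π ∈ G, π '' P ∈ sets
  finite_mem : ∀ P : Set I, P.Finite → P ∈ sets

/-- The normal ideal of all finite subsets of `I`. -/
def finiteIdeal {I : Type*} (G : Subgroup (Equiv.Perm I)) : NormalIdeal G where
  sets := {P | P.Finite}
  empty_mem := Set.finite_empty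
  subset_mem := fun _ h _ h' => Set.Finite.subset h h'
  union_mem := fun _ h _ h' => Set.Finite.union h h'
  image_mem := fun _ h _ _ => Set.Finite.image _ h
  finite_mem := fun _ h => h

/-- The permutation model `Σ(I, G, 𝓘)`: its `n`-ary predicates are those `α` with
`sym_G(α) ⊇ G(P)` for some `P` in the ideal. -/
def permModel {I : Type*} (G : Subgroup (Equiv.Perm I)) (K : NormalIdeal G) : PredStructure I where
  dom := fun _ => {α | ∃ P ∈ K.sets, fixSet G P ⊆ symSet G α}
  dom_nonempty := fun _ => ⟨fun _ => False, ∅, K.empty_mem, fun _ hπ => ⟨hπ.1, rfl⟩⟩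

/-- The permutations of `{0,1} × ℕ` that map `{0} × ℕ` to itself and `{1} × ℕ` to itself. -/
def halvesGroup : Subgroup (Equiv.Perm (Fin 2 × ℕ)) where
  carrier := {π | ∀ ξ, (π ξ).1 = ξ.1}
  one_mem' := fun _ => rfl
  mul_mem' := fun {a b} ha hb ξ => by
    rw [Equiv.Perm.mul_apply, ha, hb]
  inv_mem' := fun {a} ha ξ => by
    have h := ha (a⁻¹ ξ)
    rw [show a (a⁻¹ ξ) = ξ from Equiv.apply_symm_apply a ξ] at h
    exact h.symm

/-- The model `2Σ₀`. -/
def twoSigma0 : PredStructure (Fin 2 × ℕ) :=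
  permModel halvesGroup (finiteIdeal halvesGroup)

end HPL

/-!
The permutations in `halvesGroup` act on assignments and, since they permute every predicate domain,
preserve the truth of all second-order formulas (`sat_act`). A transposition of two points of one
half lies in the group and fixes any finite set avoiding these points. This refutes trichotomy and
linear ordering on the diagonals of the halves, that is, on the sets of constant tuples: an
injection between the diagonals of different halves, or a linear ordering of one of them, would have
a finite support `P`, and transposing two points outside `P` in one half contradicts injectivity
(`not_injective_halfDiagonal`) or antisymmetry (`models_not_LO`).

For the choice principle, let `R ξ D` be the relation defined by `H`. The formula has finitely many
parameters (`sat_congr`, `finite_freePred`), so `R` is invariant under the pointwise stabilizer of a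
finite set `P`. A finite partial injection preserving the halves extends to an element of the group
(`exists_mem_halvesGroup_extending`), which has two consequences. The stabilizer of `P` has only
finitely many orbits on `n`-tuples (`exists_mem_fixSet_comp_eq`). And a bounded number of points can
be moved into a fixed large box while `P` and `ξ` stay fixed (`exists_mem_fixSet_mapsTo_box`).
Together they give a finite `Q ⊇ P` such that every `ξ` has a witness supported by `Q` and the
entries of `ξ` (`exists_uniform_support`). Choosing such witnesses on representatives of the orbits
of the stabilizer of `Q` and transporting them along the orbits yields a choice function supported
by `Q` (`exists_uniformization`).
-/

namespace HPL

/-! ### Coincidence and equivariance of satisfaction -/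

theorem finite_freePred (φ : Formula) :
    {p : ℕ+ × ℕ | FreePred p.1 p.2 φ}.Finite := by
  induction φ with
  | eq i j => simp [FreePred]
  | rel n i v =>
    refine (Set.finite_singleton (n, i)).subset ?_
    rintro ⟨k, j⟩ ⟨h₁, h₂⟩
    exact Prod.ext h₁.symm h₂.symm
  | not φ ih => exact ih
  | and φ ψ ih₁ ih₂ => exact ih₁.union ih₂
  | or φ ψ ih₁ ih₂ => exact ih₁.union ih₂
  | imp φ ψ ih₁ ih₂ => exact ih₁.union ih₂
  | iff φ ψ ih₁ ih₂ => exact ih₁.union ih₂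
  | all i φ ih => exact ih
  | ex i φ ih => exact ih
  | allPred n i φ ih => exact ih.subset fun _ h => h.2
  | exPred n i φ ih => exact ih.subset fun _ h => h.2

theorem Assignment.setPred_apply_self {I : Type*} (f : Assignment I) (n : ℕ+) (i : ℕ)
    (α : Pred n I) : (f.setPred n i α).pred n i = α := by
  simp [setPred]

theorem Assignment.setPred_apply_of_ne {I : Type*} (f : Assignment I) {n k : ℕ+} {i j : ℕ}
    (α : Pred n I) (h : ¬ (n = k ∧ i = j)) : (f.setPred n i α).pred k j = f.pred k j := by
  by_cases hk : k = n
  · subst hk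
    have : j ≠ i := fun e => h ⟨rfl, e.symm⟩
    simp [setPred, this]
  · simp [setPred, hk]

theorem Assignment.setPred_congr {I : Type*} {f g : Assignment I} {n k : ℕ+} {i j : ℕ}
    (α : Pred n I) (h : ¬ (n = k ∧ i = j) → f.pred k j = g.pred k j) :
    (f.setPred n i α).pred k j = (g.setPred n i α).pred k j := by
  by_cases hk : n = k ∧ i = j
  · obtain ⟨rfl, rfl⟩ := hk
    rw [setPred_apply_self, setPred_apply_self]
  · rw [setPred_apply_of_ne _ _ hk, setPred_apply_of_ne _ _ hk, h hk]

/-- Coincidence lemma: the truth value of a formula is determined by the values of its free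
predicate variables and of finitely many individual variables. -/
theorem sat_congr {I : Type*} (S : PredStructure I) (φ : Formula) :
    ∃ V : Finset ℕ, ∀ f g : Assignment I, (∀ i ∈ V, f.ind i = g.ind i) →
      (∀ n i, FreePred n i φ → f.pred n i = g.pred n i) → (Sat S f φ ↔ Sat S g φ) := by
  have update {f g : Assignment I} {V : Finset ℕ} (h : ∀ i ∈ V, f.ind i = g.ind i) (i : ℕ)
      (ξ : I) : ∀ j ∈ V, (f.setInd i ξ).ind j = (g.setInd i ξ).ind j := by
    intro j hj
    simp only [Assignment.setInd, Function.update_apply, h j hj]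
  induction φ with
  | eq i j =>
    refine ⟨{i, j}, fun f g h _ => ?_⟩
    simp only [Sat, h i (by simp), h j (by simp)]
  | rel n i v =>
    refine ⟨Finset.univ.image v, fun f g h h' => ?_⟩
    simp only [Sat, h' n i ⟨rfl, rfl⟩, h _ (Finset.mem_image_of_mem v (Finset.mem_univ _))]
  | not φ ih =>
    obtain ⟨V, hV⟩ := ih
    exact ⟨V, fun f g h h' => not_congr (hV f g h h')⟩
  | and φ ψ ih₁ ih₂ | or φ ψ ih₁ ih₂ | imp φ ψ ih₁ ih₂ | iff φ ψ ih₁ ih₂ =>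
    obtain ⟨V, hV⟩ := ih₁
    obtain ⟨W, hW⟩ := ih₂
    refine ⟨V ∪ W, fun f g h h' => ?_⟩
    simp only [Sat, hV f g (fun i hi => h i (Finset.mem_union_left _ hi))
        (fun n i hi => h' n i (Or.inl hi)),
      hW f g (fun i hi => h i (Finset.mem_union_right _ hi)) (fun n i hi => h' n i (Or.inr hi))]
  | all i φ ih =>
    obtain ⟨V, hV⟩ := ih
    exact ⟨V, fun f g h h' => forall_congr' fun ξ => hV _ _ (update h i ξ) h'⟩
  | ex i φ ih =>
    obtain ⟨V, hV⟩ := ih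
    exact ⟨V, fun f g h h' => exists_congr fun ξ => hV _ _ (update h i ξ) h'⟩
  | allPred n i φ ih =>
    obtain ⟨V, hV⟩ := ih
    exact ⟨V, fun f g h h' => forall₂_congr fun α _ => hV _ _ h fun k j hk =>
      Assignment.setPred_congr α fun hne => h' k j ⟨hne, hk⟩⟩
  | exPred n i φ ih =>
    obtain ⟨V, hV⟩ := ih
    exact ⟨V, fun f g h h' => exists_congr fun α => and_congr_right fun _ => hV _ _ h fun k j hk =>
      Assignment.setPred_congr α fun hne => h' k j ⟨hne, hk⟩⟩

theorem Pred.act_mul {I : Type*} {n : ℕ+} (α : Pred n I) (π σ : Equiv.Perm I) :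
    α.act (π * σ) = (α.act σ).act π := by
  funext ξ
  simp [Pred.act]

theorem Pred.act_inv_act {I : Type*} {n : ℕ+} (α : Pred n I) (π : Equiv.Perm I) :
    (α.act π⁻¹).act π = α := by
  funext ξ
  simp [Pred.act]

theorem Pred.act_apply_comp {I : Type*} {n : ℕ+} (α : Pred n I) (π : Equiv.Perm I)
    (ξ : Fin n → I) : α.act π (π ∘ ξ) = α ξ := by
  simp [Pred.act]

/-- If `P` supports `α`, then `π P` supports `α^π`. -/
theorem fixSet_image_subset_symSet_act {I : Type*} {G : Subgroup (Equiv.Perm I)} {n : ℕ+}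
    {α : Pred n I} {P : Set I} (h : fixSet G P ⊆ symSet G α) {π : Equiv.Perm I} (hπ : π ∈ G) :
    fixSet G (π '' P) ⊆ symSet G (α.act π) := by
  rintro σ ⟨hσ, hfix⟩
  have hmem : π⁻¹ * σ * π ∈ fixSet G P :=
    ⟨G.mul_mem (G.mul_mem (G.inv_mem hπ) hσ) hπ, fun ξ hξ => by
      simp [hfix _ (Set.mem_image_of_mem π hξ)]⟩
  refine ⟨hσ, ?_⟩
  have h₂ := congrArg (fun β => Pred.act β π) (h hmem).2
  simpa only [← Pred.act_mul, ← mul_assoc, mul_inv_cancel, one_mul] using h₂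

theorem act_mem_dom {I : Type*} {G : Subgroup (Equiv.Perm I)} (K : NormalIdeal G) {n : ℕ+}
    {α : Pred n I} (hα : α ∈ (permModel G K).dom n) {π : Equiv.Perm I} (hπ : π ∈ G) :
    α.act π ∈ (permModel G K).dom n := by
  obtain ⟨P, hP, h⟩ := hα
  exact ⟨π '' P, K.image_mem P hP π hπ, fixSet_image_subset_symSet_act h hπ⟩

/-- The image of an assignment under a permutation of the individuals. -/
def Assignment.act {I : Type*} (f : Assignment I) (π : Equiv.Perm I) : Assignment I where
  ind i := π (f.ind i)
  pred n i := (f.pred n i).act π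

theorem Assignment.act_setInd {I : Type*} (f : Assignment I) (π : Equiv.Perm I) (i : ℕ) (ξ : I) :
    (f.setInd i ξ).act π = (f.act π).setInd i (π ξ) := by
  simp only [act, setInd, Assignment.mk.injEq, and_true]
  funext j
  by_cases h : j = i
  · subst h; simp
  · simp [h]

theorem Assignment.act_setPred {I : Type*} (f : Assignment I) (π : Equiv.Perm I) (n : ℕ+) (i : ℕ)
    (α : Pred n I) : (f.setPred n i α).act π = (f.act π).setPred n i (α.act π) := by
  have h : ((f.setPred n i α).act π).pred = ((f.act π).setPred n i (α.act π)).pred := by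
    funext k j
    by_cases hk : n = k ∧ i = j
    · obtain ⟨rfl, rfl⟩ := hk
      rw [setPred_apply_self]
      simp only [act, setPred_apply_self]
    · rw [setPred_apply_of_ne _ _ hk]
      simp only [act, setPred_apply_of_ne _ _ hk]
  exact congrArg (Assignment.mk _) h

/-- The permutations in `G` are automorphisms of the permutation model: they preserve
truth of all second-order formulas, since they permute every predicate domain. -/
theorem sat_act {I : Type*} {G : Subgroup (Equiv.Perm I)} (K : NormalIdeal G)
    {π : Equiv.Perm I} (hπ : π ∈ G) (φ : Formula) (f : Assignment I) :
    Sat (permModel G K) (f.act π) φ ↔ Sat (permModel G K) f φ := by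
  induction φ generalizing f with
  | eq i j => simp [Sat, Assignment.act]
  | rel n i v => simp [Sat, Assignment.act, Pred.act]
  | not φ ih => simp only [Sat, ih]
  | and φ ψ ih₁ ih₂ | or φ ψ ih₁ ih₂ | imp φ ψ ih₁ ih₂ | iff φ ψ ih₁ ih₂ =>
    simp only [Sat, ih₁, ih₂]
  | all i φ ih =>
    simp only [Sat]
    rw [← π.forall_congr_right]
    simp only [← Assignment.act_setInd, ih]
  | ex i φ ih =>
    simp only [Sat]
    rw [← π.exists_congr_right]
    simp only [← Assignment.act_setInd, ih]
  | allPred n i φ ih =>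
    simp only [Sat]
    constructor
    · intro h α hα
      rw [← ih, Assignment.act_setPred]
      exact h _ (act_mem_dom K hα hπ)
    · intro h α hα
      rw [← Pred.act_inv_act α π, ← Assignment.act_setPred, ih]
      exact h _ (act_mem_dom K hα (G.inv_mem hπ))
  | exPred n i φ ih =>
    simp only [Sat]
    constructor
    · rintro ⟨α, hα, h⟩
      rw [← Pred.act_inv_act α π, ← Assignment.act_setPred, ih] at h
      exact ⟨_, act_mem_dom K hα (G.inv_mem hπ), h⟩
    · rintro ⟨α, hα, h⟩
      rw [← ih, Assignment.act_setPred] at h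
      exact ⟨_, act_mem_dom K hα hπ, h⟩

/-! ### Tuples of variables -/

/-- Change the values of the variables `x_{v 0}, …, x_{v (k-1)}` to `ξ 0, …, ξ (k-1)`; meaningful
for injective `v`. -/
noncomputable def Assignment.setTuple {I : Type*} (f : Assignment I) {k : ℕ} (v : Fin k → ℕ)
    (ξ : Fin k → I) : Assignment I :=
  { f with ind := Function.extend v ξ f.ind }

theorem Assignment.setTuple_pred {I : Type*} (f : Assignment I) {k : ℕ} (v : Fin k → ℕ)
    (ξ : Fin k → I) : (f.setTuple v ξ).pred = f.pred := rfl

theorem Assignment.setTuple_ind_self {I : Type*} (f : Assignment I) {k : ℕ} {v : Fin k → ℕ}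
    (hv : Function.Injective v) (ξ : Fin k → I) (j : Fin k) :
    (f.setTuple v ξ).ind (v j) = ξ j :=
  hv.extend_apply ξ f.ind j

theorem Assignment.setTuple_ind_of_ne {I : Type*} (f : Assignment I) {k : ℕ} (v : Fin k → ℕ)
    (ξ : Fin k → I) {i : ℕ} (h : ∀ j, v j ≠ i) : (f.setTuple v ξ).ind i = f.ind i :=
  Function.extend_apply' ξ f.ind i fun ⟨j, hj⟩ => h j hj

theorem sat_foldr_all {I : Type*} (S : PredStructure I) (φ : Formula) (l : List ℕ)
    (f : Assignment I) : Sat S f (l.foldr Formula.all φ) ↔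
      ∀ g : ℕ → I, (∀ i ∉ l, g i = f.ind i) → Sat S ⟨g, f.pred⟩ φ := by
  induction l generalizing f with
  | nil =>
    constructor
    · intro h g hg
      obtain rfl : g = f.ind := funext fun i => hg i (by simp)
      exact h
    · intro h
      exact h f.ind fun _ _ => rfl
  | cons a l ih =>
    simp only [List.foldr_cons, Sat, ih]
    constructor
    · intro h g hg
      refine h (g a) g fun i hi => ?_
      by_cases hia : i = a
      · subst hia; simp [Assignment.setInd]
      · simp [Assignment.setInd, hia, hg i (by simp [hia, hi])]
    · intro h ξ g hg
      refine h g fun i hi => ?_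
      simp only [List.mem_cons, not_or] at hi
      simp [hg i hi.2, Assignment.setInd, hi.1]

theorem sat_foldr_ex {I : Type*} (S : PredStructure I) (φ : Formula) (l : List ℕ)
    (f : Assignment I) : Sat S f (l.foldr Formula.ex φ) ↔
      ∃ g : ℕ → I, (∀ i ∉ l, g i = f.ind i) ∧ Sat S ⟨g, f.pred⟩ φ := by
  induction l generalizing f with
  | nil =>
    constructor
    · intro h
      exact ⟨f.ind, fun _ _ => rfl, h⟩
    · rintro ⟨g, hg, h⟩
      obtain rfl : g = f.ind := funext fun i => hg i (by simp)
      exact h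
  | cons a l ih =>
    simp only [List.foldr_cons, Sat, ih]
    constructor
    · rintro ⟨ξ, g, hg, h⟩
      refine ⟨g, fun i hi => ?_, h⟩
      simp only [List.mem_cons, not_or] at hi
      simp [hg i hi.2, Assignment.setInd, hi.1]
    · rintro ⟨g, hg, h⟩
      refine ⟨g a, g, fun i hi => ?_, h⟩
      by_cases hia : i = a
      · subst hia; simp [Assignment.setInd]
      · simp [Assignment.setInd, hia, hg i (by simp [hia, hi])]

theorem Assignment.eq_setTuple {I : Type*} (f : Assignment I) {k : ℕ} {v : Fin k → ℕ}
    (hv : Function.Injective v) {g : ℕ → I} (hg : ∀ i ∉ List.ofFn v, g i = f.ind i) :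
    (⟨g, f.pred⟩ : Assignment I) = f.setTuple v (g ∘ v) := by
  refine congrArg (Assignment.mk · f.pred) (funext fun i => ?_)
  by_cases h : ∃ j, v j = i
  · obtain ⟨j, rfl⟩ := h
    exact (hv.extend_apply (g ∘ v) f.ind j).symm
  · rw [Function.extend_apply' _ _ _ h]
    exact hg i (by simpa [List.mem_ofFn] using h)

theorem sat_allTuple {I : Type*} (S : PredStructure I) (φ : Formula) {k : ℕ} {v : Fin k → ℕ}
    (hv : Function.Injective v) (f : Assignment I) :
    Sat S f (allTuple v φ) ↔ ∀ ξ : Fin k → I, Sat S (f.setTuple v ξ) φ := by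
  rw [allTuple, sat_foldr_all]
  constructor
  · exact fun h ξ => h _ fun i hi => f.setTuple_ind_of_ne v ξ (by simpa [List.mem_ofFn] using hi)
  · intro h g hg
    rw [f.eq_setTuple hv hg]
    exact h _

theorem sat_exTuple {I : Type*} (S : PredStructure I) (φ : Formula) {k : ℕ} {v : Fin k → ℕ}
    (hv : Function.Injective v) (f : Assignment I) :
    Sat S f (exTuple v φ) ↔ ∃ ξ : Fin k → I, Sat S (f.setTuple v ξ) φ := by
  rw [exTuple, sat_foldr_ex]
  constructor
  · rintro ⟨g, hg, h⟩
    rw [f.eq_setTuple hv hg] at h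
    exact ⟨_, h⟩
  · rintro ⟨ξ, h⟩
    exact ⟨_, fun i hi => f.setTuple_ind_of_ne v ξ (by simpa [List.mem_ofFn] using hi), h⟩

theorem sat_eqTuple {I : Type*} (S : PredStructure I) {k : ℕ} (v w : Fin k → ℕ)
    (f : Assignment I) : Sat S f (eqTuple v w) ↔ f.ind ∘ v = f.ind ∘ w := by
  have aux (l : List Formula) :
      Sat S f (l.foldr Formula.and (Formula.eq 0 0)) ↔ ∀ φ ∈ l, Sat S f φ := by
    induction l with
    | nil => simp [Sat]
    | cons φ l ih => simp [Sat, ih]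
  rw [eqTuple, aux, funext_iff]
  simp [List.mem_ofFn, Sat]

theorem comp_append {X Y : Type*} {n m : ℕ+} (g : X → Y) (x : Fin n → X) (y : Fin m → X) :
    g ∘ append x y = append (g ∘ x) (g ∘ y) := by
  funext i
  simp only [append, Function.comp_apply]
  generalize i.cast (PNat.add_coe n m) = j
  refine Fin.addCases (fun a => ?_) (fun a => ?_) j <;> simp

/-- The first `n` entries of an `(n+m)`-tuple. -/
def leftPart {X : Type*} {n m : ℕ+} (w : Fin (n + m : ℕ+) → X) : Fin n → X :=
  fun i => w ((Fin.castAdd m i).cast (PNat.add_coe n m).symm)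

/-- The last `m` entries of an `(n+m)`-tuple. -/
def rightPart {X : Type*} {n m : ℕ+} (w : Fin (n + m : ℕ+) → X) : Fin m → X :=
  fun i => w ((Fin.natAdd n i).cast (PNat.add_coe n m).symm)

theorem leftPart_append {X : Type*} {n m : ℕ+} (x : Fin n → X) (y : Fin m → X) :
    leftPart (append x y) = x := by
  funext i
  simp [leftPart, append]

theorem rightPart_append {X : Type*} {n m : ℕ+} (x : Fin n → X) (y : Fin m → X) :
    rightPart (append x y) = y := by
  funext i
  simp [rightPart, append]

theorem injective_left_of_append {X : Type*} {n m : ℕ+} {x : Fin n → X} {y : Fin m → X}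
    (h : Function.Injective (append x y)) : Function.Injective x := by
  rw [← leftPart_append x y]
  exact h.comp ((Fin.cast_injective _).comp (Fin.castAdd_injective _ _))

theorem injective_right_of_append {X : Type*} {n m : ℕ+} {x : Fin n → X} {y : Fin m → X}
    (h : Function.Injective (append x y)) : Function.Injective y := by
  rw [← rightPart_append x y]
  exact h.comp ((Fin.cast_injective _).comp (Fin.natAdd_injective _ _))

theorem ne_of_injective_append {X : Type*} {n m : ℕ+} {x : Fin n → X} {y : Fin m → X}
    (h : Function.Injective (append x y)) (i : Fin n) (j : Fin m) : x i ≠ y j := by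
  rw [← congrFun (leftPart_append x y) i, ← congrFun (rightPart_append x y) j]
  intro e
  have := congrArg Fin.val (h e)
  simp at this
  omega

/-! ### Homogeneity of the two halves -/

/-- A finite partial injection of `{0,1} × ℕ` that preserves the halves extends to an element of
`halvesGroup`. -/
theorem exists_mem_halvesGroup_extending {A : Set (Fin 2 × ℕ)} (hA : A.Finite)
    {g : Fin 2 × ℕ → Fin 2 × ℕ} (hinj : Set.InjOn g A) (hg : ∀ a ∈ A, (g a).1 = a.1) :
    ∃ π ∈ halvesGroup, ∀ a ∈ A, π a = g a := by
  have hfin (c : Fin 2) : Finite {k : ℕ | (c, k) ∈ A} :=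
    (hA.preimage (Prod.mk_right_injective c).injOn).to_subtype
  choose σ hσ using fun c : Fin 2 => Equiv.Perm.exists_extending_pair
    (fun k : {k : ℕ | (c, k) ∈ A} => (k : ℕ)) (fun k => (g (c, k)).2) Subtype.val_injective
    fun k l h => Subtype.ext (Prod.mk_right_injective c (hinj k.2 l.2
      (Prod.ext ((hg _ k.2).trans (hg _ l.2).symm) h)))
  refine ⟨Equiv.prodCongrRight σ, fun ξ => rfl, ?_⟩
  rintro ⟨c, k⟩ hk
  exact Prod.ext (hg _ hk).symm (hσ c ⟨k, hk⟩)

/-- The transposition of two points of the same half. -/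
theorem swap_mem_halvesGroup {ξ η : Fin 2 × ℕ} (h : ξ.1 = η.1) :
    Equiv.swap ξ η ∈ halvesGroup := by
  intro ζ
  rcases eq_or_ne ζ ξ with rfl | h₁
  · rw [Equiv.swap_apply_left, h]
  rcases eq_or_ne ζ η with rfl | h₂
  · rw [Equiv.swap_apply_right, h]
  · rw [Equiv.swap_apply_of_ne_of_ne h₁ h₂]

/-- Each half has two distinct points outside a given finite set. -/
theorem exists_pair_notMem {P : Set (Fin 2 × ℕ)} (hP : P.Finite) (c : Fin 2) :
    ∃ k l : ℕ, k ≠ l ∧ (c, k) ∉ P ∧ (c, l) ∉ P := by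
  have hfin : {k : ℕ | (c, k) ∈ P}.Finite := hP.preimage (Prod.mk_right_injective c).injOn
  obtain ⟨k, hk⟩ := hfin.exists_notMem
  obtain ⟨l, hl⟩ := (hfin.insert k).exists_notMem
  simp only [Set.mem_insert_iff, not_or] at hl
  exact ⟨k, l, fun h => hl.1 h.symm, hk, hl.2⟩

/-- The points `(c, k)` with `k < M`. -/
def initialBox (M : ℕ) : Set (Fin 2 × ℕ) := {ξ | ξ.2 < M}

theorem finite_initialBox (M : ℕ) : (initialBox M).Finite :=
  (Set.finite_univ.prod (Set.finite_lt_nat M)).subset fun _ h => ⟨Set.mem_univ _, h⟩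

/-- Pointwise fixing a finite set `C`, any small finite set `E` can be moved into a large box
together with `C`, since the box has enough points outside `C` in each half. -/
theorem exists_mem_fixSet_mapsTo_box (C E : Finset (Fin 2 × ℕ)) {M : ℕ}
    (hM : C.card + E.card ≤ M) :
    ∃ σ ∈ fixSet halvesGroup (C : Set (Fin 2 × ℕ)), ∀ e ∈ E, σ e ∈ ↑C ∪ initialBox M := by
  classical
  have hchoose (c : Fin 2) : ∃ j : ℕ → ℕ,
      {k : ℕ | (c, k) ∈ E} ⊆ j ⁻¹' {k | k < M ∧ (c, k) ∉ C} ∧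
        Set.InjOn j {k : ℕ | (c, k) ∈ E} := by
    have hfE : {k : ℕ | (c, k) ∈ E}.Finite :=
      E.finite_toSet.preimage (Prod.mk_right_injective c).injOn
    refine hfE.exists_injOn_of_encard_le ?_
    have hE : {k : ℕ | (c, k) ∈ E}.encard ≤ E.card := by
      rw [← Set.encard_coe_eq_coe_finsetCard]
      exact Set.encard_le_encard_of_injOn (f := Prod.mk c) (fun _ h => h)
        (Prod.mk_right_injective c).injOn
    have hC : (Set.range (Prod.mk c) ∩ (C : Set (Fin 2 × ℕ))).encard ≤ C.card := by
      rw [← Set.encard_coe_eq_coe_finsetCard]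
      exact Set.encard_le_encard Set.inter_subset_right
    have hCpre : {k : ℕ | (c, k) ∈ C}.encard ≤ C.card := by
      rw [← Set.encard_coe_eq_coe_finsetCard]
      exact Set.encard_le_encard_of_injOn (f := Prod.mk c) (fun _ h => h)
        (Prod.mk_right_injective c).injOn
    have hbox : (M : ℕ∞) ≤ {k | k < M ∧ (c, k) ∉ C}.encard + C.card := by
      calc (M : ℕ∞) = {k : ℕ | k < M}.encard := by
            rw [← Finset.card_range M, ← Set.encard_coe_eq_coe_finsetCard]
            congr 1
            ext k
            simp
        _ ≤ ({k | k < M ∧ (c, k) ∉ C} ∪ {k : ℕ | (c, k) ∈ C}).encard :=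
            Set.encard_le_encard fun k hk => by
              by_cases h : (c, k) ∈ C
              · exact Or.inr h
              · exact Or.inl ⟨hk, h⟩
        _ ≤ _ := (Set.encard_union_le _ _).trans (add_le_add_right hCpre _)
    have hsum : (E.card : ℕ∞) + C.card ≤ {k | k < M ∧ (c, k) ∉ C}.encard + C.card :=
      le_trans (by exact_mod_cast (by omega : E.card + C.card ≤ M)) hbox
    exact hE.trans ((ENat.add_le_add_iff_right (ENat.natCast_ne_top _)).1 hsum)
  choose j hj hinj using hchoose
  set g : Fin 2 × ℕ → Fin 2 × ℕ := fun ξ => if ξ ∈ C then ξ else (ξ.1, j ξ.1 ξ.2) with hg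
  have hginj : Set.InjOn g ↑(C ∪ E) := by
    rintro ⟨c, k⟩ hξ ⟨d, l⟩ hη heq
    simp only [Finset.coe_union, Set.mem_union, Finset.mem_coe, hg] at hξ hη heq
    split_ifs at heq with h₁ h₂ h₂
    · exact heq
    · obtain ⟨rfl, rfl⟩ := Prod.mk.inj heq
      exact absurd h₁ (hj _ (hη.resolve_left h₂)).2
    · obtain ⟨rfl, rfl⟩ := Prod.mk.inj heq
      exact absurd h₂ (hj _ (hξ.resolve_left h₁)).2
    · obtain ⟨rfl, hjj⟩ := Prod.mk.inj heq
      exact Prod.ext rfl (hinj c (hξ.resolve_left h₁) (hη.resolve_left h₂) hjj)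
  have hghalf (a) : (g a).1 = a.1 := by
    simp only [hg]
    split_ifs <;> rfl
  obtain ⟨σ, hσ, h⟩ :=
    exists_mem_halvesGroup_extending (C ∪ E).finite_toSet hginj fun a _ => hghalf a
  refine ⟨σ, ⟨hσ, fun ξ hξ => ?_⟩, fun e he => ?_⟩
  · rw [h ξ (by simp [Finset.mem_coe.1 hξ])]
    exact if_pos (Finset.mem_coe.1 hξ)
  · rw [h e (by simp [he])]
    simp only [hg]
    split_ifs with hC
    · exact Or.inl hC
    · exact Or.inr (hj e.1 he).1

/-- The type of a tuple over `P`: the halves its entries lie in, the equalities among the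
entries, and their equalities with elements of `P`. -/
def tupleType (P : Set (Fin 2 × ℕ)) {n : ℕ} (ξ : Fin n → Fin 2 × ℕ) :
    (Fin n → Fin 2) × (Fin n → Fin n → Prop) × (Fin n → P → Prop) :=
  (fun i => (ξ i).1, fun i j => ξ i = ξ j, fun i p => ξ i = p)

/-- Tuples of the same type over a finite set `P` lie in one orbit under the pointwise stabilizer
of `P`; so there are only finitely many orbits of `n`-tuples. -/
theorem exists_mem_fixSet_comp_eq {P : Set (Fin 2 × ℕ)} (hP : P.Finite) {n : ℕ}
    {ξ η : Fin n → Fin 2 × ℕ} (h : tupleType P ξ = tupleType P η) :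
    ∃ π ∈ fixSet halvesGroup P, π ∘ ξ = η := by
  classical
  simp only [tupleType, Prod.mk.injEq, funext_iff, eq_iff_iff] at h
  obtain ⟨hhalf, hpat, hpar⟩ := h
  set g : Fin 2 × ℕ → Fin 2 × ℕ := fun a => if ha : ∃ i, ξ i = a then η ha.choose else a with hgdef
  have hgξ (i : Fin n) : g (ξ i) = η i := by
    have hex : ∃ j, ξ j = ξ i := ⟨i, rfl⟩
    simp only [hgdef, dif_pos hex]
    exact (hpat _ _).1 hex.choose_spec
  have hgP {a} (ha : a ∈ P) : g a = a := by
    by_cases hex : ∃ i, ξ i = a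
    · obtain ⟨i, hi⟩ := hex
      rw [← hi, hgξ, (hpar i ⟨a, ha⟩).1 hi, hi]
    · simp only [hgdef, dif_neg hex]
  have hginj : Set.InjOn g (P ∪ Set.range ξ) := by
    rintro a (ha | ⟨i, rfl⟩) b (hb | ⟨k, rfl⟩) hab
    · rwa [hgP ha, hgP hb] at hab
    · rw [hgP ha, hgξ] at hab
      exact ((hpar k ⟨a, ha⟩).2 hab.symm).symm
    · rw [hgP hb, hgξ] at hab
      exact (hpar i ⟨b, hb⟩).2 hab
    · rw [hgξ, hgξ] at hab
      exact (hpat i k).2 hab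
  have hghalf : ∀ a ∈ P ∪ Set.range ξ, (g a).1 = a.1 := by
    rintro a (ha | ⟨i, rfl⟩)
    · rw [hgP ha]
    · rw [hgξ, hhalf i]
  obtain ⟨π, hπ, hext⟩ :=
    exists_mem_halvesGroup_extending (hP.union (Set.finite_range ξ)) hginj hghalf
  refine ⟨π, ⟨hπ, fun a ha => (hext a (Or.inl ha)).trans (hgP ha)⟩, funext fun i => ?_⟩
  exact (hext _ (Or.inr ⟨i, rfl⟩)).trans (hgξ i)

/-! ### Uniform choice from a relation with finite support -/

theorem fixSet_mono {I : Type*} {G : Subgroup (Equiv.Perm I)} {P Q : Set I} (h : P ⊆ Q) :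
    fixSet G Q ⊆ fixSet G P :=
  fun _ hπ => ⟨hπ.1, fun ξ hξ => hπ.2 ξ (h hξ)⟩

/-- If `R` is invariant under the pointwise stabilizer of a finite set `P`, then the supports of
the witnesses can be bounded uniformly: there is a finite `Q ⊇ P` such that every tuple `ξ` has a
witness supported by `Q` and the entries of `ξ`. -/
theorem exists_uniform_support {n m : ℕ+} {P : Set (Fin 2 × ℕ)} (hP : P.Finite)
    (R : (Fin n → Fin 2 × ℕ) → Pred m (Fin 2 × ℕ) → Prop)
    (hR : ∀ π ∈ fixSet halvesGroup P, ∀ ξ D, R ξ D → R (π ∘ ξ) (D.act π))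
    (hex : ∀ ξ, ∃ D ∈ twoSigma0.dom m, R ξ D) :
    ∃ Q : Set (Fin 2 × ℕ), Q.Finite ∧ P ⊆ Q ∧ ∀ ξ, ∃ D,
      fixSet halvesGroup (Q ∪ Set.range ξ) ⊆ symSet halvesGroup D ∧ R ξ D := by
  classical
  choose D hD hRD using hex
  choose E hE hED using hD
  have hE' (ξ) : (E ξ).Finite := hE ξ
  have : Finite P := hP
  -- One representative per type; only the supports of its witness have to be bounded.
  set r : (Fin n → Fin 2) × (Fin n → Fin n → Prop) × (Fin n → P → Prop) → Fin n → Fin 2 × ℕ :=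
    Function.invFun (tupleType P)
  have hr (ξ : Fin n → Fin 2 × ℕ) : tupleType P (r (tupleType P ξ)) = tupleType P ξ :=
    Function.invFun_eq ⟨ξ, rfl⟩
  obtain ⟨N, hN⟩ := (Set.finite_range fun t => (hE' (r t)).toFinset.card).bddAbove
  have hN' (t) : (hE' (r t)).toFinset.card ≤ N := hN ⟨t, rfl⟩
  refine ⟨P ∪ initialBox (hP.toFinset.card + n + N), hP.union (finite_initialBox _),
    Set.subset_union_left, fun ξ => ?_⟩
  obtain ⟨π, hπ, hπξ⟩ := exists_mem_fixSet_comp_eq hP (hr ξ)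
  set η := r (tupleType P ξ)
  set C : Finset (Fin 2 × ℕ) := hP.toFinset ∪ Finset.univ.image ξ
  have hCcard : C.card ≤ hP.toFinset.card + n :=
    (Finset.card_union_le _ _).trans
      (Nat.add_le_add_left (Finset.card_image_le.trans (by simp)) _)
  have hCcoe : (C : Set (Fin 2 × ℕ)) = P ∪ Set.range ξ := by simp [C]
  -- Fixing `P` and `ξ`, the rest of the support of the transported witness is moved into the box,
  -- whose size leaves room for it next to `P` and `ξ`.
  obtain ⟨σ, hσ, hσE⟩ := exists_mem_fixSet_mapsTo_box C ((hE' η).toFinset.image π)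
    (M := hP.toFinset.card + n + N)
    (Nat.add_le_add hCcard (Finset.card_image_le.trans (hN' _)))
  rw [hCcoe] at hσ hσE
  have hσP : σ ∈ fixSet halvesGroup P := fixSet_mono Set.subset_union_left hσ
  refine ⟨((D η).act π).act σ, ?_, ?_⟩
  · refine (fixSet_mono ?_).trans
      (fixSet_image_subset_symSet_act (fixSet_image_subset_symSet_act (hED η) hπ.1) hσ.1)
    rintro _ ⟨_, ⟨e, he, rfl⟩, rfl⟩
    rcases hσE (π e) (Finset.mem_image_of_mem _ ((hE' η).mem_toFinset.2 he)) with (h | h) | h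
    · exact Or.inl (Or.inl h)
    · exact Or.inr h
    · exact Or.inl (Or.inr h)
  · have h := hR σ hσP _ _ (hR π hπ _ _ (hRD η))
    rw [hπξ] at h
    have hσξ : σ ∘ ξ = ξ := funext fun i => hσ.2 _ (Or.inr ⟨i, rfl⟩)
    rwa [hσξ] at h

/-- Uniformization: a total relation with finite support contains the graph of a function with
finite support. Witnesses are chosen on orbit representatives and transported along the
orbits; transport along the stabilizer of the set `Q` from `exists_uniform_support` is unambiguous,
since the witness is supported by `Q` and the entries of the representative. -/
theorem exists_uniformization {n m : ℕ+} {P : Set (Fin 2 × ℕ)} (hP : P.Finite)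
    (R : (Fin n → Fin 2 × ℕ) → Pred m (Fin 2 × ℕ) → Prop)
    (hR : ∀ π ∈ fixSet halvesGroup P, ∀ ξ D, R ξ D → R (π ∘ ξ) (D.act π))
    (hex : ∀ ξ, ∃ D ∈ twoSigma0.dom m, R ξ D) :
    ∃ S ∈ twoSigma0.dom (n + m), ∀ ξ, ∃ D ∈ twoSigma0.dom m,
      R ξ D ∧ ∀ η, D η ↔ S (append ξ η) := by
  obtain ⟨Q, hQ, hPQ, hex⟩ := exists_uniform_support hP R hR hex
  choose D₀ hD₀ hRD₀ using hex
  let H : Subgroup (Equiv.Perm (Fin 2 × ℕ)) := halvesGroup ⊓ fixingSubgroup _ Q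
  have hH (π) : π ∈ H ↔ π ∈ fixSet halvesGroup Q := by
    simp only [H, Subgroup.mem_inf, mem_fixingSubgroup_iff]
    rfl
  let s : Setoid (Fin n → Fin 2 × ℕ) := MulAction.orbitRel H _
  let rep (ξ : Fin n → Fin 2 × ℕ) : Fin n → Fin 2 × ℕ := (Quotient.mk s ξ).out
  have hrep (ξ) : ∃ π ∈ H, π ∘ rep ξ = ξ := by
    obtain ⟨π, hπ⟩ : ξ ∈ MulAction.orbit H (rep ξ) := s.symm (Quotient.mk_out ξ)
    exact ⟨π, π.2, hπ⟩
  choose τ hτH hτ using hrep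
  have hrep_eq {π} (hπ : π ∈ H) (ξ) : rep (π ∘ ξ) = rep ξ :=
    congrArg Quotient.out (Quotient.sound (s := s) ⟨⟨π, hπ⟩, rfl⟩)
  let D (ξ : Fin n → Fin 2 × ℕ) : Pred m (Fin 2 × ℕ) := (D₀ (rep ξ)).act (τ ξ)
  have hDact {π} (hπ : π ∈ H) (ξ) : D (π ∘ ξ) = (D ξ).act π := by
    -- Both `π * τ ξ` and `τ (π ∘ ξ)` take the representative of the orbit to `π ∘ ξ`, so they
    -- differ by an element fixing a support of the chosen witness.
    have hρ : (π * τ ξ)⁻¹ * τ (π ∘ ξ) ∈ H :=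
      H.mul_mem (H.inv_mem (H.mul_mem hπ (hτH ξ))) (hτH _)
    have hfix : (π * τ ξ)⁻¹ * τ (π ∘ ξ) ∈ fixSet halvesGroup (Q ∪ Set.range (rep ξ)) := by
      refine ⟨((hH _).1 hρ).1, ?_⟩
      rintro a (ha | ⟨i, rfl⟩)
      · exact ((hH _).1 hρ).2 a ha
      · have h₁ := congrFun (hτ (π ∘ ξ)) i
        have h₂ := congrFun (hτ ξ) i
        simp only [hrep_eq hπ, Function.comp_apply] at h₁ h₂
        rw [Equiv.Perm.mul_apply, h₁, Equiv.Perm.inv_eq_iff_eq, Equiv.Perm.mul_apply, h₂]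
    have h := congrArg (Pred.act · (π * τ ξ)) (hD₀ (rep ξ) hfix).2
    simp only [← Pred.act_mul, mul_inv_cancel_left] at h
    simp only [D, hrep_eq hπ, h, Pred.act_mul]
  refine ⟨fun w => D (leftPart w) (rightPart w), ⟨Q, hQ, ?_⟩, fun ξ => ⟨D ξ, ?_, ?_, ?_⟩⟩
  · intro π hπ
    refine ⟨hπ.1, funext fun w => ?_⟩
    change D (⇑π⁻¹ ∘ leftPart w) (⇑π⁻¹ ∘ rightPart w) = _
    rw [hDact (H.inv_mem ((hH π).2 hπ)), Pred.act_apply_comp]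
  · exact act_mem_dom _ ⟨_, hQ.union (Set.finite_range _), hD₀ _⟩ ((hH _).1 (hτH ξ)).1
  · have h := hR _ (fixSet_mono hPQ ((hH _).1 (hτH ξ))) _ _ (hRD₀ (rep ξ))
    rwa [hτ ξ] at h
  · intro η
    simp only [leftPart_append, rightPart_append]

/-! ### The choice principle -/

/-- Every instance of the choice principle holds in the model: the relation defined by `H` is
invariant under the permutations fixing a support of the parameters of `H`, so it can be
uniformized. -/
theorem choiceH_valid (n m : ℕ+) (φ : Formula) (hφ : φ ∈ choiceH n m) : Models twoSigma0 φ := by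
  classical
  obtain ⟨x, y, d, s, H, hxy, hs, rfl⟩ := hφ
  intro f hf
  have hx := injective_left_of_append hxy
  have hy := injective_right_of_append hxy
  have hnm : n + m ≠ m := (PNat.lt_add_left m n).ne'
  simp only [choiceFormula, Sat, sat_allTuple _ _ hx, sat_allTuple _ _ hy]
  intro hex
  obtain ⟨V, hV⟩ := sat_congr twoSigma0 H
  choose P hP hPf using hf
  -- The parameters of `H` are supported by the finite set `Q`.
  set Q : Set (Fin 2 × ℕ) :=
    f.ind '' V ∪ ⋃ p ∈ {p : ℕ+ × ℕ | FreePred p.1 p.2 H}, P p.1 p.2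
  have hQ : Q.Finite :=
    (V.finite_toSet.image _).union ((finite_freePred H).biUnion fun p _ => hP p.1 p.2)
  have hinv : ∀ π ∈ fixSet halvesGroup Q, ∀ ξ D,
      Sat twoSigma0 ((f.setTuple x ξ).setPred m d D) H →
        Sat twoSigma0 ((f.setTuple x (π ∘ ξ)).setPred m d (D.act π)) H := by
    intro π hπ ξ D h
    have h' := (sat_act (finiteIdeal halvesGroup) hπ.1 _ _).2 h
    rw [Assignment.act_setPred] at h'
    refine (hV _ _ (fun i hi => ?_) fun k j hk => ?_).1 h'
    · change π ((f.setTuple x ξ).ind i) = (f.setTuple x (π ∘ ξ)).ind i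
      by_cases hxi : ∃ j, x j = i
      · obtain ⟨j, rfl⟩ := hxi
        simp only [Assignment.setTuple_ind_self _ hx, Function.comp_apply]
      · rw [not_exists] at hxi
        rw [Assignment.setTuple_ind_of_ne _ _ _ hxi, Assignment.setTuple_ind_of_ne _ _ _ hxi]
        exact hπ.2 _ (Or.inl ⟨i, hi, rfl⟩)
    · refine Assignment.setPred_congr _ fun _ => ?_
      exact (hPf k j (fixSet_mono (fun a ha => Or.inr (Set.mem_biUnion (x := (k, j)) hk ha)) hπ)).2
  obtain ⟨S, hS, hSD⟩ := exists_uniformization hQ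
    (fun ξ D => Sat twoSigma0 ((f.setTuple x ξ).setPred m d D) H) hinv hex
  refine ⟨S, hS, fun ξ => ?_⟩
  obtain ⟨D, hD, hHD, hDS⟩ := hSD ξ
  refine ⟨D, hD, fun η => ?_, ?_⟩
  · set f' := ((f.setPred (n + m) s S).setTuple x ξ).setPred m d D
    set g := f'.setTuple y η with hg
    have hx_val : g.ind ∘ x = ξ := by
      funext i
      rw [Function.comp_apply, hg,
        Assignment.setTuple_ind_of_ne _ _ _ fun j => (ne_of_injective_append hxy i j).symm]
      exact Assignment.setTuple_ind_self _ hx _ _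
    have hy_val : g.ind ∘ y = η := funext fun i => Assignment.setTuple_ind_self _ hy _ _
    have hD_val : g.pred m d = D := Assignment.setPred_apply_self _ _ _ _
    have hS_val : g.pred (n + m) s = S :=
      (Assignment.setPred_apply_of_ne ((f.setPred (n + m) s S).setTuple x ξ) D
        fun h => hnm h.1.symm).trans (Assignment.setPred_apply_self f _ _ _)
    change g.pred m d (g.ind ∘ y) ↔ g.pred (n + m) s (g.ind ∘ append x y)
    rw [comp_append, hD_val, hS_val, hx_val, hy_val]
    exact hDS η
  · refine (hV ((f.setTuple x ξ).setPred m d D)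
      (((f.setPred (n + m) s S).setTuple x ξ).setPred m d D) (fun _ _ => rfl)
      fun k j hk => ?_).1 hHD
    refine Assignment.setPred_congr D fun _ => ?_
    refine (Assignment.setPred_apply_of_ne f S (i := s) ?_).symm
    rintro ⟨rfl, rfl⟩
    exact hs hk

/-! ### Failure of trichotomy and of linear ordering -/

theorem injective_block (n : ℕ+) (b : ℕ) : Function.Injective (block n b) := by
  intro i j h
  exact Fin.ext (Nat.add_left_cancel h)

theorem block_ne (n : ℕ+) {b c : ℕ} (h : b ≠ c) (i j : Fin n) : block n b i ≠ block n c j := by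
  intro e
  have e' := congrArg (· / (n : ℕ)) e
  simp only [block, Nat.mul_comm _ (n : ℕ), Nat.mul_add_div n.pos, Nat.div_eq_of_lt i.2,
    Nat.div_eq_of_lt j.2, Nat.add_zero] at e'
  exact h e'

theorem setTuple_ind_comp_block_self {I : Type*} (f : Assignment I) (n : ℕ+) (b : ℕ)
    (ξ : Fin n → I) : (f.setTuple (block n b) ξ).ind ∘ block n b = ξ :=
  funext fun i => f.setTuple_ind_self (injective_block n b) ξ i

theorem setTuple_ind_comp_block_of_ne {I : Type*} (f : Assignment I) (n : ℕ+) {b c : ℕ}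
    (h : c ≠ b) (ξ : Fin n → I) :
    (f.setTuple (block n b) ξ).ind ∘ block n c = f.ind ∘ block n c :=
  funext fun i => f.setTuple_ind_of_ne _ ξ fun j => (block_ne n h i j).symm

theorem sat_rel_iff {I : Type*} (S : PredStructure I) (f : Assignment I) (n : ℕ+) (i : ℕ)
    (v : Fin n → ℕ) : Sat S f (.rel n i v) ↔ f.pred n i (f.ind ∘ v) := Iff.rfl

theorem sat_injFormula_iff {I : Type*} (S : PredStructure I) (f : Assignment I) (n : ℕ+)
    (h a b : ℕ) : Sat S f (injFormula n h a b) ↔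
      (∀ ξ η, f.pred (n + n) h (append ξ η) → f.pred n a ξ ∧ f.pred n b η) ∧
      (∀ ξ, f.pred n a ξ → ∃ η, f.pred (n + n) h (append ξ η)) ∧
      (∀ ξ η ζ, f.pred (n + n) h (append ξ η) ∧ f.pred (n + n) h (append ξ ζ) → η = ζ) ∧
      (∀ ξ η ζ, f.pred (n + n) h (append ξ ζ) ∧ f.pred (n + n) h (append η ζ) → ξ = η) := by
  simp only [injFormula, Sat.eq_4, Sat.eq_6, sat_allTuple _ _ (injective_block n _),
    sat_exTuple _ _ (injective_block n _), sat_rel_iff, comp_append, Assignment.setTuple_pred,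
    sat_eqTuple,
    setTuple_ind_comp_block_self, setTuple_ind_comp_block_of_ne _ n (Nat.zero_ne_one),
    setTuple_ind_comp_block_of_ne _ n (show 0 ≠ 2 by decide),
    setTuple_ind_comp_block_of_ne _ n (show 1 ≠ 2 by decide)]

theorem sat_linFormula_iff {I : Type*} (S : PredStructure I) (f : Assignment I) (n : ℕ+)
    (t a : ℕ) : Sat S f (linFormula n t a) ↔
      (∀ ξ η, f.pred (n + n) t (append ξ η) → f.pred n a ξ ∧ f.pred n a η) ∧
      (∀ ξ, f.pred n a ξ → f.pred (n + n) t (append ξ ξ)) ∧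
      (∀ ξ η, f.pred (n + n) t (append ξ η) ∧ f.pred (n + n) t (append η ξ) → ξ = η) ∧
      (∀ ξ η ζ, f.pred (n + n) t (append ξ η) ∧ f.pred (n + n) t (append η ζ) →
        f.pred (n + n) t (append ξ ζ)) ∧
      (∀ ξ η, f.pred n a ξ ∧ f.pred n a η →
        f.pred (n + n) t (append ξ η) ∨ f.pred (n + n) t (append η ξ)) := by
  simp only [linFormula, Sat.eq_4, Sat.eq_5, Sat.eq_6, sat_allTuple _ _ (injective_block n _),
    sat_rel_iff, comp_append, Assignment.setTuple_pred, sat_eqTuple,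
    setTuple_ind_comp_block_self, setTuple_ind_comp_block_of_ne _ n (Nat.zero_ne_one),
    setTuple_ind_comp_block_of_ne _ n (show 0 ≠ 2 by decide),
    setTuple_ind_comp_block_of_ne _ n (show 1 ≠ 2 by decide)]

/-- The `n`-ary predicate of the constant tuples with value in the half `c`. -/
def halfDiagonal (n : ℕ+) (c : Fin 2) : Pred n (Fin 2 × ℕ) :=
  fun ξ => ∃ k : ℕ, ξ = fun _ => (c, k)

theorem halfDiagonal_mem_dom (n : ℕ+) (c : Fin 2) : halfDiagonal n c ∈ twoSigma0.dom n := by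
  have key {π} (hπ : π ∈ halvesGroup) {ξ} (h : halfDiagonal n c ξ) :
      halfDiagonal n c (π ∘ ξ) := by
    obtain ⟨k, rfl⟩ := h
    exact ⟨(π (c, k)).2, funext fun _ => Prod.ext (hπ (c, k)) rfl⟩
  refine ⟨∅, Set.finite_empty, fun π hπ =>
    ⟨hπ.1, funext fun ξ => propext ⟨fun h => ?_, fun h => ?_⟩⟩⟩
  · have h' := key hπ.1 (show halfDiagonal n c (⇑π⁻¹ ∘ ξ) from h)
    rwa [← Function.comp_assoc, ← Equiv.Perm.coe_mul, mul_inv_cancel, Equiv.Perm.coe_one,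
      Function.id_comp] at h'
  · exact key (halvesGroup.inv_mem hπ.1) h

/-- A binary relation between `n`-tuples in the model is invariant under the permutations that fix
a support of it. -/
theorem append_comp_of_mem_symSet {n : ℕ+} {F : Pred (n + n) (Fin 2 × ℕ)}
    {π : Equiv.Perm (Fin 2 × ℕ)} (hπ : π ∈ symSet halvesGroup F) {ξ η : Fin n → Fin 2 × ℕ}
    (h : F (append ξ η)) : F (append (π ∘ ξ) (π ∘ η)) := by
  rw [← comp_append, ← hπ.2]
  exact (Pred.act_apply_comp F π (append ξ η)).symm ▸ h

/-- No predicate with finite support is an injective map of the diagonal of one half into the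
diagonal of the other one: transposing two arguments outside the support fixes the value. -/
theorem not_injective_halfDiagonal {n : ℕ+} {c d : Fin 2} (hcd : c ≠ d)
    {F : Pred (n + n) (Fin 2 × ℕ)} (hF : F ∈ twoSigma0.dom (n + n))
    (hmap : ∀ ξ η, F (append ξ η) → halfDiagonal n c ξ ∧ halfDiagonal n d η)
    (htot : ∀ ξ, halfDiagonal n c ξ → ∃ η, F (append ξ η))
    (hinj : ∀ ξ η ζ, F (append ξ ζ) ∧ F (append η ζ) → ξ = η) : False := by
  obtain ⟨P, hP, hPF⟩ := hF
  obtain ⟨k, l, hkl, hk, hl⟩ := exists_pair_notMem hP c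
  obtain ⟨η, hη⟩ := htot (fun _ => (c, k)) ⟨k, rfl⟩
  obtain ⟨p, rfl⟩ := (hmap _ _ hη).2
  have hπ : Equiv.swap (c, k) (c, l) ∈ fixSet halvesGroup P :=
    ⟨swap_mem_halvesGroup rfl, fun ξ hξ => Equiv.swap_apply_of_ne_of_ne
      (fun h => hk (h ▸ hξ)) (fun h => hl (h ▸ hξ))⟩
  have h := append_comp_of_mem_symSet (hPF hπ) hη
  have hp : Equiv.swap (c, k) (c, l) (d, p) = (d, p) := Equiv.swap_apply_of_ne_of_ne
    (fun h => hcd (congrArg Prod.fst h).symm) (fun h => hcd (congrArg Prod.fst h).symm)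
  have hη' : ⇑(Equiv.swap (c, k) (c, l)) ∘ (fun _ : Fin n => (d, p)) = fun _ => (d, p) :=
    funext fun _ => hp
  rw [hη'] at h
  have heq := congrFun (hinj _ _ _ ⟨hη, h⟩) ⟨0, n.pos⟩
  simp only [Function.comp_apply, Equiv.swap_apply_left, Prod.mk.injEq, true_and] at heq
  exact hkl heq

/-- Neither of the diagonals of the two halves can be mapped injectively into the other one by a
predicate with finite support. -/
theorem models_not_TR (n : ℕ+) : Models twoSigma0 (.not (TR n)) := by
  have hn : n + n ≠ n := (PNat.lt_add_left n n).ne'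
  intro f _
  simp only [TR, Sat]
  intro h
  specialize h _ (halfDiagonal_mem_dom n 0) _ (halfDiagonal_mem_dom n 1)
  have h₀ (F : Pred (n + n) (Fin 2 × ℕ)) :
      (((f.setPred n 0 (halfDiagonal n 0)).setPred n 1 (halfDiagonal n 1)).setPred
        (n + n) 0 F).pred n 0 = halfDiagonal n 0 := by
    rw [Assignment.setPred_apply_of_ne _ _ (fun h => hn h.1),
      Assignment.setPred_apply_of_ne _ _ (by simp), Assignment.setPred_apply_self]
  have h₁ (F : Pred (n + n) (Fin 2 × ℕ)) :
      (((f.setPred n 0 (halfDiagonal n 0)).setPred n 1 (halfDiagonal n 1)).setPred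
        (n + n) 0 F).pred n 1 = halfDiagonal n 1 := by
    rw [Assignment.setPred_apply_of_ne _ _ (fun h => hn h.1), Assignment.setPred_apply_self]
  simp only [sat_injFormula_iff, h₀, h₁, Assignment.setPred_apply_self] at h
  rcases h with ⟨F, hF, hmap, htot, -, hinj⟩ | ⟨F, hF, hmap, htot, -, hinj⟩
  · exact not_injective_halfDiagonal Fin.zero_ne_one hF hmap htot hinj
  · exact not_injective_halfDiagonal Fin.zero_ne_one.symm hF hmap htot hinj

/-- The diagonal of a half has no linear ordering with finite support: transposing two points
outside the support would reverse the order of their tuples. -/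
theorem models_not_LO (n : ℕ+) : Models twoSigma0 (.not (LO n)) := by
  have hn : n + n ≠ n := (PNat.lt_add_left n n).ne'
  intro f _
  simp only [LO, Sat]
  intro h
  obtain ⟨T, hT, h⟩ := h _ (halfDiagonal_mem_dom n 0)
  have h₀ : ((f.setPred n 0 (halfDiagonal n 0)).setPred (n + n) 0 T).pred n 0
      = halfDiagonal n 0 := by
    rw [Assignment.setPred_apply_of_ne _ _ (fun h => hn h.1), Assignment.setPred_apply_self]
  simp only [sat_linFormula_iff, h₀, Assignment.setPred_apply_self] at h
  obtain ⟨-, -, hanti, -, htotal⟩ := h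
  obtain ⟨P, hP, hPT⟩ := hT
  obtain ⟨k, l, hkl, hk, hl⟩ := exists_pair_notMem hP 0
  have hπ : Equiv.swap ((0 : Fin 2), k) (0, l) ∈ fixSet halvesGroup P :=
    ⟨swap_mem_halvesGroup rfl, fun ξ hξ => Equiv.swap_apply_of_ne_of_ne
      (fun h => hk (h ▸ hξ)) (fun h => hl (h ▸ hξ))⟩
  have hkπ : ⇑(Equiv.swap ((0 : Fin 2), k) (0, l)) ∘ (fun _ : Fin n => ((0 : Fin 2), k))
      = fun _ => (0, l) := funext fun _ => Equiv.swap_apply_left _ _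
  have hlπ : ⇑(Equiv.swap ((0 : Fin 2), k) (0, l)) ∘ (fun _ : Fin n => ((0 : Fin 2), l))
      = fun _ => (0, k) := funext fun _ => Equiv.swap_apply_right _ _
  have heq : (fun _ : Fin n => ((0 : Fin 2), k)) = fun _ => (0, l) := by
    rcases htotal (fun _ => (0, k)) (fun _ => (0, l)) ⟨⟨k, rfl⟩, ⟨l, rfl⟩⟩ with h | h
    · have h' := append_comp_of_mem_symSet (hPT hπ) h
      rw [hkπ, hlπ] at h'
      exact hanti _ _ ⟨h, h'⟩
    · have h' := append_comp_of_mem_symSet (hPT hπ) h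
      rw [hkπ, hlπ] at h'
      exact hanti _ _ ⟨h', h⟩
  exact hkl (congrArg Prod.snd (congrFun heq ⟨0, n.pos⟩))

end HPL

theorem proposition4 :
    (∀ n : ℕ+, HPL.Models HPL.twoSigma0 (HPL.Formula.not (HPL.TR n))) ∧
    (∀ n : ℕ+, HPL.Models HPL.twoSigma0 (HPL.Formula.not (HPL.LO n))) ∧
    (∀ n m : ℕ+, ∀ φ ∈ HPL.choiceH n m, HPL.Models HPL.twoSigma0 φ) :=
  ⟨HPL.models_not_TR, HPL.models_not_LO, HPL.choiceH_valid⟩
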